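/- \textbf{Theorem (Wedderburn decomposition over finite fields).} Let $\mathbb{F}_q$ be a finite field with $q$ elements, let $\vec m=(m_1,\dots,m_n)$ be a tuple of positive integers, and let $$\mathcal{C}_{\vec m/\mathbb{F}_q}:=\mathbb{F}_q[X_1,\dots,X_n]/(X_1^{m_1}-1,\dots,X_n^{m_n}-1)$$ be the associated circulant ring. Assume that $\mathcal{C}_{\vec m/\mathbb{F}_q}$ is semisimple. Let $\operatorname{Div}_{\vec m}$ be the set of tuples $\vec d=(d_1,\dots,d_n)$ of positive integers with $d_i\mid m_i$ for all $i$, and for $\vec d\in\operatorname{Div}_{\vec m}$ put $$\mathbb{Z}_{\vec m}(\vec d):=\Big\{x\in\prod_{i=1}^n\mathbb{Z}/m_i\mathbb{Z} : \gcd(x_i,m_i)=d_i\text{ for all }i\Big\},$$ $$\nu(\vec d):=\operatorname{lcm}_{1\le i\le n}\operatorname{ord}_{m_i/d_i}(q),\qquad \eta(\vec d):=\frac{\prod_{i=1}^n\varphi(m_i/d_i)}{\nu(\vec d)},$$ where $\operatorname{ord}_{m}(q)$ is the multiplicative order of $q$ modulo $m$ and $\varphi$ is Euler's totient function. Then for every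 $\vec d\in\operatorname{Div}_{\vec m}$ the number $\nu(\vec d)$ is a positive integer, $\#\mathbb{Z}_{\vec m}(\vec d)=\prod_{i=1}^n\varphi(m_i/d_i)$, and $\eta(\vec d)$ is an integer; and there is an isomorphism of $\mathbb{F}_q$-algebras $$\mathcal{C}_{\vec m/\mathbb{F}_q}\;\cong\;\bigoplus_{\vec d\in\operatorname{Div}_{\vec m}}\left(\mathbb{F}_{q^{\nu(\vec d)}}\right)^{\eta(\vec d)}.$$ -/

import Mathlib

open Polynomial in
/-- The field `𝔽_{q ^ r}` (for `r ≥ 1`) as an extension of the finite field `F = 𝔽_q`: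
the splitting field of `X ^ (q ^ r) - X` over `F`. -/
abbrev FiniteFieldExt (F : Type*) [Field F] (r : ℕ) : Type _ :=
  (X ^ (Nat.card F ^ r) - X : F[X]).SplittingField

/-- Sanity check: `FiniteFieldExt F r` has degree `r` over `F`, hence `q ^ r` elements. -/
theorem finrank_finiteFieldExt (F : Type*) [Field F] [Finite F] (r : ℕ) (hr : r ≠ 0) :
    Module.finrank F (FiniteFieldExt F r) = r := by
  obtain ⟨p, hp⟩ := CharP.exists F
  have : Fact (Nat.Prime p) := ⟨CharP.char_is_prime F p⟩
  have : NeZero r := ⟨hr⟩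
  have e := Polynomial.IsSplittingField.algEquiv (FiniteField.Extension F p r)
    (Polynomial.X ^ (Nat.card F ^ r) - Polynomial.X : Polynomial F)
  rw [← e.toLinearEquiv.finrank_eq, FiniteField.finrank_extension]

theorem natCard_finiteFieldExt (F : Type*) [Field F] [Finite F] (r : ℕ) (hr : r ≠ 0) :
    Nat.card (FiniteFieldExt F r) = Nat.card F ^ r := by
  rw [Module.natCard_eq_pow_finrank (K := F), finrank_finiteFieldExt F r hr]

/-- The cyclotomic ideal `(X_1 ^ m_1 - 1, …, X_n ^ m_n - 1)` of `F[X_1, …, X_n]`. -/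
noncomputable def cyclotomicIdeal (F : Type*) [Field F] {n : ℕ} (m : Fin n → ℕ) :
    Ideal (MvPolynomial (Fin n) F) :=
  Ideal.span (Set.range fun i : Fin n => (MvPolynomial.X i ^ m i - 1 : MvPolynomial (Fin n) F))

/-- The circulant ring `C_{m/F} = F[X_1, …, X_n] / (X_1 ^ m_1 - 1, …, X_n ^ m_n - 1)`. -/
abbrev CirculantRing (F : Type*) [Field F] {n : ℕ} (m : Fin n → ℕ) : Type _ :=
  MvPolynomial (Fin n) F ⧸ cyclotomicIdeal F m

/-- `Div_m`: the tuples `(d_1, …, d_n)` of positive integers with `d_i ∣ m_i` for all `i`. -/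
def divTuples {n : ℕ} (m : Fin n → ℕ) : Finset (Fin n → ℕ) :=
  Fintype.piFinset fun i => (m i).divisors

/-- `ℤ_m(d)`: the points `x` of `∏ i, ℤ / m_i` with `gcd (x_i, m_i) = d_i` for all `i`. -/
def stratum {n : ℕ} (m d : Fin n → ℕ) : Set ((i : Fin n) → ZMod (m i)) :=
  {x | ∀ i, Nat.gcd (x i).val (m i) = d i}

/-- `ν(d) = lcm_i ord_{m_i / d_i}(q)`, the order being that of `q` modulo `m_i / d_i`. -/
noncomputable def componentDegree (q : ℕ) {n : ℕ} (m d : Fin n → ℕ) : ℕ :=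
  Finset.univ.lcm fun i : Fin n => orderOf ((q : ℕ) : ZMod (m i / d i))

/-- `η(d) = (∏ i, φ(m_i / d_i)) / ν(d)`. -/
noncomputable def componentMultiplicity (q : ℕ) {n : ℕ} (m d : Fin n → ℕ) : ℕ :=
  (∏ i : Fin n, Nat.totient (m i / d i)) / componentDegree q m d

/-! A commutative semisimple ring is the product of its residue fields, so it suffices to sort the
maximal ideals by the orders `e i ∣ m i` of the generators in the residue field. That field is
generated by roots of unity, and its degree is the order of Frobenius, hence the lcm of the orders
of `q` modulo `e i` (`finrank_eq_lcm_orderOf`). The number of ideals of type `e` comes from counting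
homomorphisms to an algebraic closure twice. Choosing images of the generators gives `∏ φ(e i)` of
them (`card_algHom_orderOf`), as semisimplicity makes each `m i` invertible in `F`
(`natCast_ne_zero`). Grouping by kernel, each ideal accounts for as many as its degree
(`card_algHom_orderOf_eq_mul`). With `e = m / d` this yields `η(d)` and its integrality. -/

/-- The product of an algebra family indexed by a sigma type, constant on the fibres, curried. -/
def AlgEquiv.piSigmaCurry (R : Type*) [CommSemiring R] {ι : Type*} (J : ι → Type*) (B : ι → Type*)
    [∀ i, Semiring (B i)] [∀ i, Algebra R (B i)] :
    ((x : (i : ι) × J i) → B x.1) ≃ₐ[R] ((i : ι) → J i → B i) where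
  __ := Equiv.piCurry fun i (_ : J i) => B i
  map_mul' _ _ := rfl
  map_add' _ _ := rfl
  commutes' _ := rfl

theorem FiniteFieldExt.nonempty_algEquiv (F L : Type*) [Field F] [Finite F] [Field L] [Algebra F L]
    [FiniteDimensional F L] (r : ℕ) (h : Module.finrank F L = r) :
    Nonempty (L ≃ₐ[F] FiniteFieldExt F r) := by
  have hr : r ≠ 0 := h ▸ Module.finrank_pos.ne'
  obtain ⟨p, hp⟩ := CharP.exists F
  have : Fact (Nat.Prime p) := ⟨CharP.char_is_prime F p⟩
  have : NeZero r := ⟨hr⟩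
  exact ⟨(FiniteField.algEquivExtension F p r L h).trans
    (FiniteField.algEquivExtension F p r _ (finrank_finiteFieldExt F r hr)).symm⟩

/-- A finite field generated by elements `x i` over `𝔽_q` has degree the least common multiple of
the orders of `q` modulo the multiplicative orders of the `x i`. -/
theorem finrank_eq_lcm_orderOf {F L : Type*} [Field F] [Finite F] [Field L] [Algebra F L]
    [FiniteDimensional F L] {ι : Type*} [Fintype ι] (x : ι → L) (hx : ∀ i, x i ≠ 0)
    (hgen : Algebra.adjoin F (Set.range x) = ⊤) :
    Module.finrank F L =
      Finset.univ.lcm fun i => orderOf ((Nat.card F : ℕ) : ZMod (orderOf (x i))) := by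
  have := Fintype.ofFinite F
  have : Finite L := Module.finite_of_finite F
  -- Both sides have the same multiples `k`: Frobenius to the `k` is trivial iff it fixes every
  -- generator, i.e. `q ^ k ≡ 1` modulo each order.
  refine Nat.dvd_right_iff_eq.mp fun k => ?_
  rw [← FiniteField.orderOf_frobeniusAlgHom F L, orderOf_dvd_iff_pow_eq_one, Finset.lcm_dvd_iff]
  have hfrob : ∀ y : L, (FiniteField.frobeniusAlgHom F L ^ k) y = y ^ Nat.card F ^ k := by
    intro y
    rw [AlgHom.coe_pow, FiniteField.coe_frobeniusAlgHom, pow_iterate, Nat.card_eq_fintype_card]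
  have hord : ∀ i, orderOf ((Nat.card F : ℕ) : ZMod (orderOf (x i))) ∣ k ↔
      x i ^ Nat.card F ^ k = x i := by
    intro i
    have hu := pow_eq_pow_iff_modEq (x := Units.mk0 (x i) (hx i)) (n := Nat.card F ^ k) (m := 1)
    rw [← orderOf_units, Units.ext_iff, Units.val_pow_eq_pow_val, Units.val_pow_eq_pow_val,
      Units.val_mk0, pow_one] at hu
    rw [orderOf_dvd_iff_pow_eq_one, ← Nat.cast_pow, ← Nat.cast_one, ZMod.natCast_eq_natCast_iff, hu]
  simp only [Finset.mem_univ, true_imp_iff, hord]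
  constructor
  · intro h i
    rw [← hfrob, h, AlgHom.one_apply]
  · intro h
    refine AlgHom.ext_of_adjoin_eq_top hgen ?_
    rintro _ ⟨i, rfl⟩
    rw [hfrob, h, AlgHom.one_apply]

theorem ncard_stratum {n : ℕ} (m d : Fin n → ℕ) (hm : ∀ i, 0 < m i) (hd : ∀ i, d i ∣ m i) :
    (stratum m d).ncard = ∏ i, Nat.totient (m i / d i) := by
  have : stratum m d = Set.univ.pi fun i => {x : ZMod (m i) | Nat.gcd x.val (m i) = d i} := by
    ext x; simp [stratum]
  rw [this, ← Nat.card_coe_set_eq, Nat.card_congr (Equiv.Set.univPi _), Nat.card_pi]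
  refine Finset.prod_congr rfl fun i _ => ?_
  have : NeZero (m i) := ⟨(hm i).ne'⟩
  rw [Nat.totient_div_of_dvd (hd i), Nat.card_coe_set_eq, Set.ncard_eq_toFinset_card']
  refine Finset.card_bij (fun x _ => x.val) (fun x hx => ?_)
    (fun x _ y _ h => ZMod.val_injective _ h) fun k hk => ?_
  · rw [Set.mem_toFinset] at hx
    exact Finset.mem_filter.2 ⟨Finset.mem_range.2 x.val_lt, (Nat.gcd_comm _ _).trans hx⟩
  · obtain ⟨hk, hg⟩ := Finset.mem_filter.1 hk
    have hv : (k : ZMod (m i)).val = k := ZMod.val_cast_of_lt (Finset.mem_range.1 hk)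
    refine ⟨(k : ZMod (m i)), ?_, hv⟩
    rw [Set.mem_toFinset, Set.mem_ofPred_eq, hv, Nat.gcd_comm, hg]

theorem card_orderOf_eq (K : Type*) [Field K] [IsAlgClosed K] (e : ℕ) (he : (e : K) ≠ 0) :
    Nat.card {x : K // orderOf x = e} = Nat.totient e := by
  have : NeZero (e : K) := ⟨he⟩
  have h0 : 0 < e := Nat.pos_of_ne_zero fun h => he (by simp [h])
  obtain ⟨ζ, hζ⟩ := HasEnoughRootsOfUnity.exists_primitiveRoot K e
  rw [← hζ.card_primitiveRoots, ← Nat.card_eq_finsetCard]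
  refine Nat.card_congr (Equiv.subtypeEquivRight fun x => ?_)
  rw [mem_primitiveRoots h0, IsPrimitiveRoot.iff_orderOf]

/-! ### Homomorphisms and maximal ideals of the circulant ring -/

namespace CirculantRing

variable {F : Type*} [Field F] {n : ℕ} {m : Fin n → ℕ}

/-- The class of `X_i` in the circulant ring. -/
noncomputable def coord (F : Type*) [Field F] {n : ℕ} (m : Fin n → ℕ) (i : Fin n) :
    CirculantRing F m :=
  Ideal.Quotient.mk _ (MvPolynomial.X i)

theorem coord_pow (i : Fin n) : coord F m i ^ m i = 1 := by
  rw [coord, ← map_pow, ← sub_eq_zero, ← map_one (Ideal.Quotient.mk (cyclotomicIdeal F m)),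
    ← map_sub, Ideal.Quotient.eq_zero_iff_mem]
  exact Ideal.subset_span ⟨i, rfl⟩

theorem adjoin_coord : Algebra.adjoin F (Set.range (coord F m)) = ⊤ := by
  have h : Set.range (coord F m) =
      Ideal.Quotient.mkₐ F (cyclotomicIdeal F m) '' Set.range MvPolynomial.X := by
    rw [← Set.range_comp]; rfl
  rw [h, Algebra.adjoin_image, MvPolynomial.adjoin_range_X, Algebra.map_top,
    (AlgHom.range_eq_top _).2 (Ideal.Quotient.mkₐ_surjective F _)]

/-- The algebra homomorphism out of the circulant ring with prescribed values on the generators. -/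
noncomputable def liftCoord {A : Type*} [CommRing A] [Algebra F A] (x : Fin n → A)
    (hx : ∀ i, x i ^ m i = 1) : CirculantRing F m →ₐ[F] A :=
  Ideal.Quotient.liftₐ _ (MvPolynomial.aeval x) fun a ha => by
    have : cyclotomicIdeal F m ≤ RingHom.ker (MvPolynomial.aeval x : _ →ₐ[F] A) := by
      rw [cyclotomicIdeal, Ideal.span_le]
      rintro _ ⟨i, rfl⟩
      simp [RingHom.mem_ker, hx]
    exact this ha

theorem liftCoord_coord {A : Type*} [CommRing A] [Algebra F A] (x : Fin n → A)
    (hx : ∀ i, x i ^ m i = 1) (i : Fin n) : liftCoord (F := F) x hx (coord F m i) = x i := by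
  exact (Ideal.Quotient.liftₐ_apply _ _ _ _).trans <|
    (Ideal.Quotient.lift_mk _ _ _).trans (MvPolynomial.aeval_X x i)

/-- If `m i = p * k` in characteristic `p`, then `(x ^ k - 1) ^ p = x ^ m i - 1 = 0` for the `i`-th
generator `x`, so reducedness forces `x ^ k = 1`. -/
theorem natCast_ne_zero [IsReduced (CirculantRing F m)] {i : Fin n} (hm : 0 < m i) :
    (m i : F) ≠ 0 := by
  classical
  intro h0
  obtain ⟨p, hp⟩ := CharP.exists F
  obtain ⟨k, hk⟩ := (CharP.cast_eq_zero_iff F p _).1 h0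
  have hp0 : p ≠ 0 := by rintro rfl; simp at hk; omega
  have hpp : Nat.Prime p := (CharP.char_is_prime_or_zero F p).resolve_right hp0
  have : Fact p.Prime := ⟨hpp⟩
  have hk0 : 0 < k := Nat.pos_of_ne_zero fun h => by simp [h] at hk; omega
  have hz : coord F m i ^ k = 1 := by
    by_cases hC : Nontrivial (CirculantRing F m)
    · have : CharP (CirculantRing F m) p := charP_of_injective_algebraMap
        (algebraMap F (CirculantRing F m)).injective p
      rw [← sub_eq_zero]
      refine pow_eq_zero_iff hp0 |>.1 ?_
      rw [sub_pow_char, ← pow_mul, mul_comm, ← hk, coord_pow, one_pow, sub_self]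
    · rw [not_nontrivial_iff_subsingleton] at hC
      exact Subsingleton.elim _ _
  let P : Polynomial F := Polynomial.X ^ m i - 1
  -- Sending the other generators to `1` isolates the `i`-th, whose image cannot satisfy `x ^ k = 1`
  -- because `k < m i`.
  let x : Fin n → AdjoinRoot P := fun j => if j = i then AdjoinRoot.root P else 1
  have hx : ∀ j, x j ^ m j = 1 := by
    intro j
    by_cases hj : j = i
    · subst hj
      have := AdjoinRoot.eval₂_root P
      simpa [x, P, sub_eq_zero] using this
    · simp [x, hj]
  have h1 := congrArg (liftCoord (F := F) x hx) hz
  rw [map_pow, liftCoord_coord, map_one] at h1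
  simp only [x, if_true] at h1
  have h2 : AdjoinRoot.mk P (Polynomial.X ^ k - 1) = 0 := by simp [h1]
  rw [AdjoinRoot.mk_eq_zero] at h2
  have hne : (Polynomial.X ^ k - 1 : Polynomial F) ≠ 0 := Polynomial.X_pow_sub_C_ne_zero hk0 1
  have h3 := Polynomial.natDegree_le_of_dvd h2 hne
  have e1 : P.natDegree = m i := Polynomial.natDegree_X_pow_sub_C (r := (1 : F))
  have e2 : (Polynomial.X ^ k - 1 : Polynomial F).natDegree = k :=
    Polynomial.natDegree_X_pow_sub_C (r := (1 : F))
  rw [e1, e2, hk] at h3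
  nlinarith [hpp.two_le]

/-- The multiplicative orders of the generators at a maximal ideal. -/
noncomputable def coordOrder (M : MaximalSpectrum (CirculantRing F m)) (i : Fin n) : ℕ :=
  orderOf (Ideal.Quotient.mk M.asIdeal (coord F m i))

theorem coordOrder_dvd (M : MaximalSpectrum (CirculantRing F m)) (i : Fin n) :
    coordOrder M i ∣ m i :=
  orderOf_dvd_of_pow_eq_one (by rw [← map_pow, coord_pow, map_one])

theorem finrank_quotient [Finite F] [Module.Finite F (CirculantRing F m)] (hm : ∀ i, 0 < m i)
    (M : MaximalSpectrum (CirculantRing F m)) :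
    Module.finrank F (CirculantRing F m ⧸ M.asIdeal) =
      Finset.univ.lcm fun i => orderOf ((Nat.card F : ℕ) : ZMod (coordOrder M i)) := by
  let := Ideal.Quotient.field M.asIdeal
  have hx : ∀ i, Ideal.Quotient.mk M.asIdeal (coord F m i) ≠ 0 := fun i h => by
    have h1 : Ideal.Quotient.mk M.asIdeal (coord F m i) ^ m i = 1 := by
      rw [← map_pow, coord_pow, map_one]
    rw [h, zero_pow (hm i).ne'] at h1
    exact zero_ne_one h1
  have : FiniteDimensional F (CirculantRing F m ⧸ M.asIdeal) :=
    Module.Finite.of_surjective (Ideal.Quotient.mkₐ F M.asIdeal).toLinearMap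
      (Ideal.Quotient.mkₐ_surjective F _)
  refine finrank_eq_lcm_orderOf (fun i => Ideal.Quotient.mk M.asIdeal (coord F m i)) hx ?_
  have h : (Set.range fun i => Ideal.Quotient.mk M.asIdeal (coord F m i)) =
      Ideal.Quotient.mkₐ F M.asIdeal '' Set.range (coord F m) := by
    rw [← Set.range_comp]; rfl
  rw [h, Algebra.adjoin_image, adjoin_coord, Algebra.map_top,
    (AlgHom.range_eq_top _).2 (Ideal.Quotient.mkₐ_surjective F _)]

theorem card_algHom_orderOf (K : Type*) [Field K] [IsAlgClosed K] [Algebra F K] {e : Fin n → ℕ}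
    (he : ∀ i, e i ∣ m i) (hm : ∀ i, (m i : F) ≠ 0) :
    Nat.card {f : CirculantRing F m →ₐ[F] K // ∀ i, orderOf (f (coord F m i)) = e i} =
      ∏ i, Nat.totient (e i) := by
  have hK : ∀ i, (e i : K) ≠ 0 := by
    intro i h
    obtain ⟨k, hk⟩ := he i
    refine hm i ((algebraMap F K).injective ?_)
    rw [map_natCast, hk, Nat.cast_mul, h, zero_mul, map_zero]
  rw [← Finset.prod_congr rfl fun i _ => card_orderOf_eq K (e i) (hK i), ← Nat.card_pi]
  refine Nat.card_congr (Equiv.ofBijective (fun f i => ⟨f.1 (coord F m i), f.2 i⟩) ⟨?_, ?_⟩)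
  · intro f g hfg
    refine Subtype.ext (AlgHom.ext_of_adjoin_eq_top adjoin_coord ?_)
    rintro _ ⟨i, rfl⟩
    exact congrArg Subtype.val (congrFun hfg i)
  · intro x
    have hx : ∀ i, (x i).1 ^ m i = 1 := fun i =>
      orderOf_dvd_iff_pow_eq_one.1 ((x i).2.symm ▸ he i :)
    refine ⟨⟨liftCoord (fun i => (x i).1) hx, fun i => ?_⟩, ?_⟩
    · rw [liftCoord_coord]; exact (x i).2
    · ext i; exact liftCoord_coord _ hx i

/-- A homomorphism to `K` is its kernel, maximal since the ring is Artinian, plus an embedding of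
the residue field. Embeddings preserve orders, and by separability there are as many as the degree.
-/
theorem card_algHom_orderOf_eq_mul [Finite F] [Module.Finite F (CirculantRing F m)]
    (K : Type*) [Field K] [IsAlgClosed K] [Algebra F K] (hm : ∀ i, 0 < m i) (e : Fin n → ℕ) :
    Nat.card {f : CirculantRing F m →ₐ[F] K // ∀ i, orderOf (f (coord F m i)) = e i} =
      Nat.card {M : MaximalSpectrum (CirculantRing F m) // coordOrder M = e} *
        Finset.univ.lcm fun i => orderOf ((Nat.card F : ℕ) : ZMod (e i)) := by
  have : IsArtinianRing (CirculantRing F m) := IsArtinianRing.of_finite F _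
  have hinj : ∀ (M : MaximalSpectrum (CirculantRing F m))
      (g : CirculantRing F m ⧸ M.asIdeal →ₐ[F] K), Function.Injective g := fun M g => by
    let := Ideal.Quotient.field M.asIdeal
    exact g.toRingHom.injective
  have hord : ∀ (M : MaximalSpectrum (CirculantRing F m))
      (g : CirculantRing F m ⧸ M.asIdeal →ₐ[F] K) (i : Fin n),
      orderOf (g (Ideal.Quotient.mk M.asIdeal (coord F m i))) = coordOrder M i := fun M g i =>
    orderOf_injective (g : CirculantRing F m ⧸ M.asIdeal →* K) (hinj M g) _
  let Φ : ((M : {M : MaximalSpectrum (CirculantRing F m) // coordOrder M = e}) ×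
      (CirculantRing F m ⧸ M.1.asIdeal →ₐ[F] K)) →
      {f : CirculantRing F m →ₐ[F] K // ∀ i, orderOf (f (coord F m i)) = e i} :=
    fun x => ⟨x.2.comp (Ideal.Quotient.mkₐ F x.1.1.asIdeal), fun i =>
      (hord x.1.1 x.2 i).trans (congrFun x.1.2 i)⟩
  have hΦ : Function.Bijective Φ := by
    constructor
    · rintro ⟨⟨M, hM⟩, g⟩ ⟨⟨N, hN⟩, g'⟩ h
      have h' : g.comp (Ideal.Quotient.mkₐ F M.asIdeal) = g'.comp (Ideal.Quotient.mkₐ F N.asIdeal) :=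
        congrArg Subtype.val h
      have hker : ∀ (M : MaximalSpectrum (CirculantRing F m))
          (g : CirculantRing F m ⧸ M.asIdeal →ₐ[F] K) (c : CirculantRing F m),
          g.comp (Ideal.Quotient.mkₐ F M.asIdeal) c = 0 ↔ c ∈ M.asIdeal := fun M g c => by
        rw [AlgHom.comp_apply, map_eq_zero_iff g (hinj M g), Ideal.Quotient.mkₐ_eq_mk,
          Ideal.Quotient.eq_zero_iff_mem]
      obtain rfl : M = N := MaximalSpectrum.ext (Ideal.ext fun c => by
        rw [← hker M g, h', hker N g'])
      obtain rfl : g = g' := Ideal.Quotient.algHom_ext F h'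
      rfl
    · rintro ⟨f, hf⟩
      have hmax : (RingHom.ker f).IsMaximal :=
        have := RingHom.ker_isPrime f
        IsArtinianRing.isMaximal_of_isPrime _
      let g : CirculantRing F m ⧸ RingHom.ker f →ₐ[F] K :=
        Ideal.Quotient.liftₐ (RingHom.ker f) f fun a ha => ha
      have hg : g.comp (Ideal.Quotient.mkₐ F (RingHom.ker f)) = f :=
        Ideal.Quotient.liftₐ_comp _ f fun a ha => ha
      let M : MaximalSpectrum (CirculantRing F m) := ⟨RingHom.ker f, hmax⟩
      refine ⟨⟨⟨M, ?_⟩, g⟩, Subtype.ext hg⟩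
      funext i
      rw [← hord M g i, ← hf i]
      exact congrArg orderOf (AlgHom.congr_fun hg _)
  have hcard : ∀ M : {M : MaximalSpectrum (CirculantRing F m) // coordOrder M = e},
      Nat.card (CirculantRing F m ⧸ M.1.asIdeal →ₐ[F] K) =
        Finset.univ.lcm fun i => orderOf ((Nat.card F : ℕ) : ZMod (e i)) := by
    intro M
    let := Ideal.Quotient.field M.1.asIdeal
    rw [Nat.card_eq_fintype_card, AlgHom.card, finrank_quotient hm, M.2]
  have := Fintype.ofFinite {M : MaximalSpectrum (CirculantRing F m) // coordOrder M = e}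
  rw [← Nat.card_congr (Equiv.ofBijective Φ hΦ), Nat.card_sigma,
    Finset.sum_congr rfl fun M _ => hcard M, Finset.sum_const, smul_eq_mul, Finset.card_univ,
    Nat.card_eq_fintype_card (α := {M : MaximalSpectrum (CirculantRing F m) // coordOrder M = e})]

end CirculantRing

open CirculantRing in
theorem mainTheorem2 {F : Type*} [Field F] [Finite F] {n : ℕ} (m : Fin n → ℕ)
    (hm : ∀ i, 0 < m i) (hss : IsSemisimpleRing (CirculantRing F m)) :
    (∀ d ∈ divTuples m,
      0 < componentDegree (Nat.card F) m d ∧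
      (stratum m d).ncard = ∏ i : Fin n, Nat.totient (m i / d i) ∧
      componentDegree (Nat.card F) m d ∣ ∏ i : Fin n, Nat.totient (m i / d i)) ∧
    Nonempty (CirculantRing F m ≃ₐ[F]
      ((d : divTuples m) → Fin (componentMultiplicity (Nat.card F) m d.1) →
        FiniteFieldExt F (componentDegree (Nat.card F) m d.1))) := by
  have hfin : Module.Finite F (CirculantRing F m) := Module.finite_of_isSemisimpleRing F _
  have : IsArtinianRing (CirculantRing F m) := IsArtinianRing.of_finite F _
  have hmF : ∀ i, (m i : F) ≠ 0 := fun i => natCast_ne_zero (hm i)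
  have hdvd : ∀ d ∈ divTuples m, ∀ i, d i ∣ m i := fun d hd i =>
    Nat.dvd_of_mem_divisors (Fintype.mem_piFinset.1 hd i)
  have hcount : ∀ d ∈ divTuples m,
      Nat.card {M : MaximalSpectrum (CirculantRing F m) // coordOrder M = fun i => m i / d i} *
        componentDegree (Nat.card F) m d = ∏ i, Nat.totient (m i / d i) := fun d hd => by
    rw [← card_algHom_orderOf (AlgebraicClosure F) (e := fun i => m i / d i)
      (fun i => Nat.div_dvd_of_dvd (hdvd d hd i)) hmF, card_algHom_orderOf_eq_mul _ hm]
    rfl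
  have hpos : ∀ d ∈ divTuples m, 0 < componentDegree (Nat.card F) m d := fun d hd => by
    -- `orderOf` defaults to `0`, so positivity is read off the count: a factor of a nonzero product
    -- is nonzero.
    have h : 0 < ∏ i, Nat.totient (m i / d i) := Finset.prod_pos fun i _ =>
      Nat.totient_pos.2 (Nat.div_pos (Nat.le_of_dvd (hm i) (hdvd d hd i))
        (Nat.pos_of_dvd_of_pos (hdvd d hd i) (hm i)))
    rw [← hcount d hd] at h
    exact Nat.pos_of_mul_pos_left h
  refine ⟨fun d hd => ⟨hpos d hd, ncard_stratum m d hm (hdvd d hd), Dvd.intro_left _ (hcount d hd)⟩,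
    ?_⟩
  have hmult : ∀ d ∈ divTuples m,
      Nat.card {M : MaximalSpectrum (CirculantRing F m) // coordOrder M = fun i => m i / d i} =
        componentMultiplicity (Nat.card F) m d := fun d hd =>
    (Nat.div_eq_of_eq_mul_left (hpos d hd) (hcount d hd).symm).symm
  -- `e ↦ m / e` is an involution on divisor tuples, so the fibre of `δ` over `d` is the set of
  -- ideals of type `m / d`.
  let δ : MaximalSpectrum (CirculantRing F m) → divTuples m := fun M =>
    ⟨fun i => m i / coordOrder M i, Fintype.mem_piFinset.2 fun i =>
      Nat.mem_divisors.2 ⟨Nat.div_dvd_of_dvd (coordOrder_dvd M i), (hm i).ne'⟩⟩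
  have hδ : ∀ M d, δ M = d ↔ coordOrder M = fun i => m i / d.1 i := by
    intro M d
    rw [Subtype.ext_iff, funext_iff, funext_iff]
    refine forall_congr' fun i => ⟨fun h => ?_, fun h => ?_⟩
    · rw [← h, Nat.div_div_self (coordOrder_dvd M i) (hm i).ne']
    · exact (congrArg (m i / ·) h).trans (Nat.div_div_self (hdvd d.1 d.2 i) (hm i).ne')
  have hfib : ∀ d : divTuples m,
      Nonempty (Fin (componentMultiplicity (Nat.card F) m d.1) ≃ {M // δ M = d}) := fun d => by
    refine ⟨(Finite.equivFinOfCardEq ?_).symm⟩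
    rw [← hmult d.1 d.2]
    exact Nat.card_congr (Equiv.subtypeEquivRight fun M => hδ M d)
  let efib := fun d => (hfib d).some
  let σ : ((d : divTuples m) × Fin (componentMultiplicity (Nat.card F) m d.1)) ≃
      MaximalSpectrum (CirculantRing F m) :=
    (Equiv.sigmaCongrRight efib).trans (Equiv.sigmaFiberEquiv δ)
  have hσ : ∀ x, Nonempty ((CirculantRing F m ⧸ (σ x).asIdeal) ≃ₐ[F]
      FiniteFieldExt F (componentDegree (Nat.card F) m x.1.1)) := fun x => by
    let := Ideal.Quotient.field (σ x).asIdeal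
    refine FiniteFieldExt.nonempty_algEquiv F _ _ ?_
    rw [finrank_quotient hm, (hδ (σ x) x.1).1 (efib x.1 x.2).2]
    rfl
  let eσ := fun x => (hσ x).some
  -- Split into residue fields, reindex by `σ`, identify each field by its degree, then curry.
  exact ⟨((IsArtinianRing.equivPi (CirculantRing F m)).restrictScalars F).trans <|
    (AlgEquiv.piCongrLeft F (fun M : MaximalSpectrum (CirculantRing F m) =>
      CirculantRing F m ⧸ M.asIdeal) σ).symm.trans <|
    (AlgEquiv.piCongrRight eσ).trans <|
    AlgEquiv.piSigmaCurry F _ fun d : divTuples m =>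
      FiniteFieldExt F (componentDegree (Nat.card F) m d.1)⟩
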